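/- Let $\mathbb{K}$ be a field of characteristic different from $2$. A (non-associative) $\mathbb{K}$-algebra is a $\mathbb{K}$-vector space with a bilinear multiplication. A variety of $\mathbb{K}$-algebras is the class of all $\mathbb{K}$-algebras in which every polynomial of a given set $I$ of non-associative polynomials over $\mathbb{K}$ vanishes under all assignments of elements to the variables; it is regarded as a category with the $\mathbb{K}$-linear multiplicative maps as morphisms. This category is pointed and has finite sums $+$, finite products $\times$ and kernels. For objects $X,Y,Z$ of such a category, let $X\diamond Y$ with inclusion $\iota_{X,Y}\colon X\diamond Y\to X+Y$ be the kernel of the canonical morphism $\left(\begin{smallmatrix}1_X&0\\0&1_Y\end{smallmatrix}\right)\colon X+Y\to X\times Y$, and let $X\diamond Y\diamond Z$ be the kernel of the canonical morphism $X+Y+Z\to (X+Y)\times(X+Z)\times(Y+Z)$ whose components send, respectively, the summands $Z$, $Y$, $X$ to $0$ and are the coproduct inclusions on the other two summands. The morphisms $$X\diamond(Y\diamond Z)\xrightarrow{\iota_{X,Y\diamond Z}} X+(Y\diamond Z)\xrightarrow{1_X+\iota_{Y,Z}}X+Y+Z \quad\text{and}\quad (X\diamond Y)\diamond Z\xrightarrow{\iota_{X\diamond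 Y,Z}} (X\diamond Y)+Z\xrightarrow{\iota_{X,Y}+1_Z}X+Y+Z$$ factor uniquely through $X\diamond Y\diamond Z$, which gives canonical comparison maps $\Phi_{X,Y,Z}\colon X\diamond(Y\diamond Z)\to X\diamond Y\diamond Z$ and $\Psi_{X,Y,Z}\colon (X\diamond Y)\diamond Z\to X\diamond Y\diamond Z$. The category is called cosmash associative if $\Phi_{X,Y,Z}$ and $\Psi_{X,Y,Z}$ are isomorphisms for all objects $X,Y,Z$. Let $\mathcal{V}$ be a variety of $\mathbb{K}$-algebras all of whose members are anti-commutative ($xy+yx=0$) and anti-associative ($x(yz)+(xy)z=0$). If $\mathcal{V}$ is cosmash associative, then $\mathcal{V}$ is abelian: $xy=0$ for all elements $x,y$ of every algebra in $\mathcal{V}$. -/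

import Mathlib

open CategoryTheory CategoryTheory.Limits

universe u v w

/-! ### Cosmash products in a pointed category -/

section Cosmash

universe v₁ u₁

variable {C : Type u₁} [Category.{v₁} C] [HasZeroMorphisms C] [HasFiniteCoproducts C]
  [HasFiniteProducts C] [HasKernels C]

/-- The canonical morphism `X + Y ⟶ X × Y` given by the identity matrix. -/
noncomputable def binSigma (X Y : C) : X ⨿ Y ⟶ X ⨯ Y :=
  coprod.desc (prod.lift (𝟙 X) 0) (prod.lift 0 (𝟙 Y))

/-- The binary cosmash product `X ⋄ Y`. -/
noncomputable def cosmash (X Y : C) : C := kernel (binSigma X Y)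

/-- The inclusion `X ⋄ Y ⟶ X + Y`. -/
noncomputable def cosmashι (X Y : C) : cosmash X Y ⟶ X ⨿ Y := kernel.ι (binSigma X Y)

/-- The canonical morphism `X + Y + Z ⟶ (X + Y) × (X + Z) × (Y + Z)`, each component of which
kills one of the three summands. -/
noncomputable def terSigma (X Y Z : C) : X ⨿ (Y ⨿ Z) ⟶ (X ⨿ Y) ⨯ ((X ⨿ Z) ⨯ (Y ⨿ Z)) :=
  prod.lift (coprod.desc coprod.inl (coprod.desc coprod.inr 0))
    (prod.lift (coprod.desc coprod.inl (coprod.desc 0 coprod.inr))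
      (coprod.desc 0 (coprod.desc coprod.inl coprod.inr)))

/-- The ternary cosmash product `X ⋄ Y ⋄ Z`. -/
noncomputable def terCosmash (X Y Z : C) : C := kernel (terSigma X Y Z)

/-- The inclusion `X ⋄ Y ⋄ Z ⟶ X + Y + Z`. -/
noncomputable def terCosmashι (X Y Z : C) : terCosmash X Y Z ⟶ X ⨿ (Y ⨿ Z) :=
  kernel.ι (terSigma X Y Z)

lemma cosmashι_binSigma (X Y : C) : cosmashι X Y ≫ binSigma X Y = 0 := kernel.condition _

lemma cosmashι_desc_fst (X Y : C) : cosmashι X Y ≫ coprod.desc (𝟙 X) (0 : Y ⟶ X) = 0 := by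
  have h : binSigma X Y ≫ prod.fst = coprod.desc (𝟙 X) (0 : Y ⟶ X) := by
    ext <;> simp [binSigma, coprod.inl_desc, coprod.inr_desc, prod.lift_fst]
  rw [← h, ← Category.assoc, cosmashι_binSigma, zero_comp]

lemma cosmashι_desc_snd (X Y : C) : cosmashι X Y ≫ coprod.desc (0 : X ⟶ Y) (𝟙 Y) = 0 := by
  have h : binSigma X Y ≫ prod.snd = coprod.desc (0 : X ⟶ Y) (𝟙 Y) := by
    ext <;> simp [binSigma, coprod.inl_desc, coprod.inr_desc, prod.lift_snd]
  rw [← h, ← Category.assoc, cosmashι_binSigma, zero_comp]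

lemma cosmashι_desc_left {X Y W : C} (f : X ⟶ W) :
    cosmashι X Y ≫ coprod.desc f (0 : Y ⟶ W) = 0 := by
  have h : coprod.desc f (0 : Y ⟶ W) = coprod.desc (𝟙 X) (0 : Y ⟶ X) ≫ f := by
    ext <;> simp
  rw [h, ← Category.assoc, cosmashι_desc_fst, zero_comp]

lemma cosmashι_desc_right {X Y W : C} (f : Y ⟶ W) :
    cosmashι X Y ≫ coprod.desc (0 : X ⟶ W) f = 0 := by
  have h : coprod.desc (0 : X ⟶ W) f = coprod.desc (0 : X ⟶ Y) (𝟙 Y) ≫ f := by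
    ext <;> simp
  rw [h, ← Category.assoc, cosmashι_desc_snd, zero_comp]

lemma phi_condition (X Y Z : C) :
    (cosmashι X (cosmash Y Z) ≫ coprod.map (𝟙 X) (cosmashι Y Z)) ≫ terSigma X Y Z = 0 := by
  ext
  · simp only [terSigma, Category.assoc, prod.lift_fst, zero_comp, coprod.map_desc,
      Category.id_comp, cosmashι_desc_left]
  · simp only [terSigma, Category.assoc, prod.lift_fst, prod.lift_snd, zero_comp, coprod.map_desc,
      Category.id_comp, cosmashι_desc_right, cosmashι_desc_left]
  · simp only [terSigma, Category.assoc, prod.lift_snd, zero_comp, coprod.map_desc,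
      Category.id_comp, cosmashι_desc_right]

lemma psi_condition (X Y Z : C) :
    (cosmashι (cosmash X Y) Z ≫ coprod.map (cosmashι X Y) (𝟙 Z) ≫
      (coprod.associator X Y Z).hom) ≫ terSigma X Y Z = 0 := by
  have h1 : (coprod.associator X Y Z).hom ≫ coprod.desc coprod.inl (coprod.desc coprod.inr 0)
      = coprod.desc (𝟙 (X ⨿ Y)) 0 := by ext <;> simp [coprod.inl_desc, coprod.inr_desc]
  have h2 : (coprod.associator X Y Z).hom ≫ coprod.desc coprod.inl (coprod.desc 0 coprod.inr)
      = coprod.desc (coprod.desc (coprod.inl : X ⟶ X ⨿ Z) 0) coprod.inr := by ext <;> simp [coprod.inl_desc, coprod.inr_desc]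
  have h3 : (coprod.associator X Y Z).hom ≫ coprod.desc 0 (coprod.desc coprod.inl coprod.inr)
      = coprod.desc (coprod.desc 0 (coprod.inl : Y ⟶ Y ⨿ Z)) coprod.inr := by ext <;> simp [coprod.inl_desc, coprod.inr_desc]
  ext
  · simp only [terSigma, Category.assoc, prod.lift_fst, zero_comp, h1, coprod.map_desc,
      comp_zero, cosmashι_desc_left]
  · simp only [terSigma, Category.assoc, prod.lift_fst, prod.lift_snd, zero_comp, h2,
      coprod.map_desc, Category.id_comp, cosmashι_desc_right, cosmashι_desc_left]
  · simp only [terSigma, Category.assoc, prod.lift_snd, zero_comp, h3, coprod.map_desc,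
      Category.id_comp, cosmashι_desc_right]

/-- The canonical comparison map `Φ : X ⋄ (Y ⋄ Z) ⟶ X ⋄ Y ⋄ Z`. -/
noncomputable def cosmashPhi (X Y Z : C) : cosmash X (cosmash Y Z) ⟶ terCosmash X Y Z :=
  kernel.lift (terSigma X Y Z)
    (cosmashι X (cosmash Y Z) ≫ coprod.map (𝟙 X) (cosmashι Y Z)) (phi_condition X Y Z)

/-- The canonical comparison map `Ψ : (X ⋄ Y) ⋄ Z ⟶ X ⋄ Y ⋄ Z`. -/
noncomputable def cosmashPsi (X Y Z : C) : cosmash (cosmash X Y) Z ⟶ terCosmash X Y Z :=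
  kernel.lift (terSigma X Y Z)
    (cosmashι (cosmash X Y) Z ≫ coprod.map (cosmashι X Y) (𝟙 Z) ≫
      (coprod.associator X Y Z).hom) (psi_condition X Y Z)

variable (C) in
/-- A pointed category with finite sums, finite products and kernels is cosmash associative
when both canonical comparison maps are invertible for all triples of objects. -/
def CosmashAssociative [HasZeroObject C] : Prop :=
  ∀ X Y Z : C, IsIso (cosmashPhi X Y Z) ∧ IsIso (cosmashPsi X Y Z)

end Cosmash

/-! ### Non-associative algebras, identities and varieties -/

section Identities

variable (K : Type u) [Field K]

/-- The non-associative polynomial `φ` in the variables `T` is an identity of the `K`-algebra `A`: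
it vanishes under every assignment of elements of `A` to the variables. -/
def IsIdentityOf {T : Type w} (φ : FreeNonUnitalNonAssocAlgebra K T) (A : Type*)
    [NonUnitalNonAssocRing A] [Module K A] [IsScalarTower K A A] [SMulCommClass K A A] : Prop :=
  ∀ a : T → A, FreeNonUnitalNonAssocAlgebra.lift K a φ = 0

end Identities

/-- `x y + y x = 0`. -/
def IsAntiCommutative (A : Type*) [NonUnitalNonAssocRing A] : Prop :=
  ∀ x y : A, x * y + y * x = 0

/-- `x (y z) + (x y) z = 0`. -/
def IsAntiAssociative (A : Type*) [NonUnitalNonAssocRing A] : Prop :=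
  ∀ x y z : A, x * (y * z) + (x * y) * z = 0

/-- `x y = 0`. -/
def IsAbelianAlgebra (A : Type*) [NonUnitalNonAssocRing A] : Prop :=
  ∀ x y : A, x * y = 0

/-- The variety of `K`-algebras determined by a set `I` of non-associative polynomials:
the (not necessarily associative or unital) `K`-algebras satisfying all identities in `I`. -/
structure VarietyAlg {K : Type u} [Field K] {T : Type w}
    (I : Set (FreeNonUnitalNonAssocAlgebra K T)) : Type (max u v + 1) where
  /-- The underlying set. -/
  carrier : Type (max u v)
  [ring : NonUnitalNonAssocRing carrier]
  [module : Module K carrier]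
  [isScalarTower : IsScalarTower K carrier carrier]
  [smulCommClass : SMulCommClass K carrier carrier]
  sat : ∀ φ ∈ I, IsIdentityOf K φ carrier

namespace VarietyAlg

variable {K : Type u} [Field K] {T : Type w} {I : Set (FreeNonUnitalNonAssocAlgebra K T)}

instance : CoeSort (VarietyAlg.{u, v, w} I) (Type (max u v)) := ⟨VarietyAlg.carrier⟩

attribute [instance] ring module isScalarTower smulCommClass

/-- Morphisms are `K`-linear multiplicative maps. -/
@[ext]
structure Hom (A B : VarietyAlg.{u, v, w} I) : Type (max u v) where
  /-- The underlying algebra homomorphism. -/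
  hom : A →ₙₐ[K] B

instance : Category.{max u v} (VarietyAlg.{u, v, w} I) where
  Hom A B := Hom A B
  id A := ⟨NonUnitalAlgHom.id K A⟩
  comp f g := ⟨g.hom.comp f.hom⟩

@[ext]
lemma hom_ext {A B : VarietyAlg.{u, v, w} I} {f g : A ⟶ B} (h : ∀ x, f.hom x = g.hom x) :
    f = g :=
  Hom.ext (NonUnitalAlgHom.ext h)

@[simp]
lemma id_hom_apply {A : VarietyAlg.{u, v, w} I} (x : A) : Hom.hom (𝟙 A) x = x := rfl

@[simp]
lemma comp_hom_apply {A B C : VarietyAlg.{u, v, w} I} (f : A ⟶ B) (g : B ⟶ C) (x : A) :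
    (f ≫ g).hom x = g.hom (f.hom x) := rfl

instance : HasZeroMorphisms (VarietyAlg.{u, v, w} I) where
  zero A B := ⟨⟨0⟩⟩
  comp_zero f Z := rfl
  zero_comp X Y Z f := by
    ext x
    exact map_zero f.hom

@[simp]
lemma zero_hom_apply {A B : VarietyAlg.{u, v, w} I} (x : A) : (0 : A ⟶ B).hom x = 0 := rfl

lemma map_lift {A B : Type*}
    [NonUnitalNonAssocRing A] [Module K A] [IsScalarTower K A A] [SMulCommClass K A A]
    [NonUnitalNonAssocRing B] [Module K B] [IsScalarTower K B B] [SMulCommClass K B B]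
    (f : A →ₙₐ[K] B) (a : T → A) (φ : FreeNonUnitalNonAssocAlgebra K T) :
    f (FreeNonUnitalNonAssocAlgebra.lift K a φ) =
      FreeNonUnitalNonAssocAlgebra.lift K (fun t => f (a t)) φ := by
  have h : f.comp (FreeNonUnitalNonAssocAlgebra.lift K a) =
      FreeNonUnitalNonAssocAlgebra.lift K (fun t => f (a t)) := by
    apply FreeNonUnitalNonAssocAlgebra.hom_ext
    intro x
    simp
  exact DFunLike.congr_fun h φ

/-! #### The zero object -/

variable (I) in
/-- The trivial algebra. -/
def zeroAlg : VarietyAlg.{u, v, w} I where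
  carrier := PUnit
  sat _ _ _ := rfl

instance : HasZeroObject (VarietyAlg.{u, v, w} I) where
  zero := ⟨zeroAlg I, by
    rw [IsZero.iff_id_eq_zero]
    ext x
    rfl⟩

/-! #### Products -/

/-- The cartesian product of two algebras. -/
def prodAlg (A B : VarietyAlg.{u, v, w} I) : VarietyAlg.{u, v, w} I where
  carrier := A × B
  sat φ hφ a := by
    refine Prod.ext ?_ ?_
    · exact (map_lift (NonUnitalAlgHom.fst K A B) a φ).trans (A.sat φ hφ _)
    · exact (map_lift (NonUnitalAlgHom.snd K A B) a φ).trans (B.sat φ hφ _)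

instance : HasBinaryProducts (VarietyAlg.{u, v, w} I) :=
  have (A B : VarietyAlg.{u, v, w} I) : HasLimit (pair A B) :=
    ⟨⟨⟨BinaryFan.mk (P := prodAlg A B) ⟨NonUnitalAlgHom.fst K A B⟩ ⟨NonUnitalAlgHom.snd K A B⟩,
      BinaryFan.IsLimit.mk _ (fun f g => ⟨NonUnitalAlgHom.prod f.hom g.hom⟩)
        (fun f g => rfl) (fun f g => rfl)
        (by
          rintro T f g m rfl rfl
          rfl)⟩⟩⟩
  hasBinaryProducts_of_hasLimit_pair _

instance : HasFiniteProducts (VarietyAlg.{u, v, w} I) :=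
  hasFiniteProducts_of_has_binary_and_terminal

/-! #### Kernels -/

/-- The kernel of a morphism, as a subset with the induced operations. -/
def kerSub {A B : VarietyAlg.{u, v, w} I} (f : A ⟶ B) : NonUnitalSubalgebra K A where
  carrier := {x | f.hom x = 0}
  add_mem' {x y} hx hy := by
    change f.hom (x + y) = 0
    rw [map_add, show f.hom x = 0 from hx, show f.hom y = 0 from hy, add_zero]
  zero_mem' := map_zero f.hom
  mul_mem' {x y} hx _ := by
    change f.hom (x * y) = 0
    rw [map_mul, show f.hom x = 0 from hx, zero_mul]
  smul_mem' c x hx := by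
    change f.hom (c • x) = 0
    rw [map_smul, show f.hom x = 0 from hx, smul_zero]

/-- The kernel of a morphism. -/
def kerAlg {A B : VarietyAlg.{u, v, w} I} (f : A ⟶ B) : VarietyAlg.{u, v, w} I where
  carrier := kerSub f
  sat φ hφ a := by
    apply Subtype.ext
    exact (map_lift (NonUnitalSubalgebraClass.subtype (kerSub f)) a φ).trans (A.sat φ hφ _)

/-- The inclusion of the kernel. -/
def kerι {A B : VarietyAlg.{u, v, w} I} (f : A ⟶ B) : kerAlg f ⟶ A :=
  ⟨NonUnitalSubalgebraClass.subtype (kerSub f)⟩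

instance : HasKernels (VarietyAlg.{u, v, w} I) where
  has_limit {A B} f :=
    ⟨⟨⟨KernelFork.ofι (kerι f) (by ext x; exact x.2),
      KernelFork.IsLimit.ofι _ _
        (fun {W} g hg => ⟨NonUnitalAlgHom.codRestrict g.hom (kerSub f)
          (fun x => DFunLike.congr_fun (congrArg Hom.hom hg) x)⟩)
        (fun {W} g hg => rfl)
        (by
          rintro W g hg m rfl
          rfl)⟩⟩⟩

/-! #### Coproducts -/

section Coproduct

variable (A B : VarietyAlg.{u, v, w} I)

/-- The free non-associative algebra on the disjoint union of `A` and `B`. -/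
abbrev CoprodFree : Type (max u v) := FreeNonUnitalNonAssocAlgebra K (A ⊕ B)

/-- The congruence conditions for the coproduct: `p` is a two-sided ideal containing all values of
the identities in `I`, modulo which both inclusions `A → CoprodFree A B` and `B → CoprodFree A B`
are algebra homomorphisms. -/
structure IsCoprodIdeal (p : Submodule K (CoprodFree A B)) : Prop where
  mul_left : ∀ x y, y ∈ p → x * y ∈ p
  mul_right : ∀ x y, x ∈ p → x * y ∈ p
  sat : ∀ φ ∈ I, ∀ a : T → CoprodFree A B, FreeNonUnitalNonAssocAlgebra.lift K a φ ∈ p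
  inl_add : ∀ x y : A, FreeNonUnitalNonAssocAlgebra.of K (Sum.inl (x + y)) -
    (FreeNonUnitalNonAssocAlgebra.of K (Sum.inl x) +
      FreeNonUnitalNonAssocAlgebra.of K (Sum.inl y)) ∈ p
  inl_mul : ∀ x y : A, FreeNonUnitalNonAssocAlgebra.of K (Sum.inl (x * y)) -
    FreeNonUnitalNonAssocAlgebra.of K (Sum.inl x) *
      FreeNonUnitalNonAssocAlgebra.of K (Sum.inl y) ∈ p
  inl_smul : ∀ (c : K) (x : A), FreeNonUnitalNonAssocAlgebra.of K (Sum.inl (c • x)) -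
    c • FreeNonUnitalNonAssocAlgebra.of K (Sum.inl x) ∈ p
  inr_add : ∀ x y : B, FreeNonUnitalNonAssocAlgebra.of K (Sum.inr (x + y)) -
    (FreeNonUnitalNonAssocAlgebra.of K (Sum.inr x) +
      FreeNonUnitalNonAssocAlgebra.of K (Sum.inr y)) ∈ p
  inr_mul : ∀ x y : B, FreeNonUnitalNonAssocAlgebra.of K (Sum.inr (x * y)) -
    FreeNonUnitalNonAssocAlgebra.of K (Sum.inr x) *
      FreeNonUnitalNonAssocAlgebra.of K (Sum.inr y) ∈ p
  inr_smul : ∀ (c : K) (x : B), FreeNonUnitalNonAssocAlgebra.of K (Sum.inr (c • x)) -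
    c • FreeNonUnitalNonAssocAlgebra.of K (Sum.inr x) ∈ p

/-- The smallest such ideal. -/
noncomputable def coprodIdeal : Submodule K (CoprodFree A B) := sInf {p | IsCoprodIdeal A B p}

lemma coprodIdeal_isCoprodIdeal : IsCoprodIdeal A B (coprodIdeal A B) where
  mul_left x y h := Submodule.mem_sInf.2 fun p hp =>
    hp.mul_left x y (Submodule.mem_sInf.1 h p hp)
  mul_right x y h := Submodule.mem_sInf.2 fun p hp =>
    hp.mul_right x y (Submodule.mem_sInf.1 h p hp)
  sat φ h a := Submodule.mem_sInf.2 fun _ hp => hp.sat φ h a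
  inl_add x y := Submodule.mem_sInf.2 fun _ hp => hp.inl_add x y
  inl_mul x y := Submodule.mem_sInf.2 fun _ hp => hp.inl_mul x y
  inl_smul x y := Submodule.mem_sInf.2 fun _ hp => hp.inl_smul x y
  inr_add x y := Submodule.mem_sInf.2 fun _ hp => hp.inr_add x y
  inr_mul x y := Submodule.mem_sInf.2 fun _ hp => hp.inr_mul x y
  inr_smul x y := Submodule.mem_sInf.2 fun _ hp => hp.inr_smul x y

/-- The underlying vector space of the coproduct. -/
def CoprodCarrier : Type (max u v) := CoprodFree A B ⧸ coprodIdeal A B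

noncomputable instance : AddCommGroup (CoprodCarrier A B) :=
  inferInstanceAs (AddCommGroup (CoprodFree A B ⧸ coprodIdeal A B))

noncomputable instance : Module K (CoprodCarrier A B) :=
  inferInstanceAs (Module K (CoprodFree A B ⧸ coprodIdeal A B))

/-- The quotient map. -/
noncomputable def coprodMk : CoprodFree A B →ₗ[K] CoprodCarrier A B := (coprodIdeal A B).mkQ

lemma coprodMk_surjective : Function.Surjective (coprodMk A B) :=
  Submodule.mkQ_surjective _

lemma coprodMk_eq_iff {x y : CoprodFree A B} :
    coprodMk A B x = coprodMk A B y ↔ x - y ∈ coprodIdeal A B :=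
  Submodule.Quotient.eq _

noncomputable instance : Mul (CoprodCarrier A B) where
  mul := Quotient.map₂ (· * ·) (by
    intro x x' hx y y' hy
    have hx' : x - x' ∈ coprodIdeal A B := (Submodule.quotientRel_def _).1 hx
    have hy' : y - y' ∈ coprodIdeal A B := (Submodule.quotientRel_def _).1 hy
    refine (Submodule.quotientRel_def _).2 ?_
    have h : x * y - x' * y' = (x - x') * y + x' * (y - y') := by
      rw [sub_mul, mul_sub]; abel
    rw [h]
    exact Submodule.add_mem _ ((coprodIdeal_isCoprodIdeal A B).mul_right _ _ hx')
      ((coprodIdeal_isCoprodIdeal A B).mul_left _ _ hy'))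

lemma coprodMk_mul (x y : CoprodFree A B) :
    coprodMk A B (x * y) = coprodMk A B x * coprodMk A B y := rfl

noncomputable instance : NonUnitalNonAssocRing (CoprodCarrier A B) :=
  { (inferInstance : AddCommGroup (CoprodCarrier A B)),
    (inferInstance : Mul (CoprodCarrier A B)) with
    left_distrib := by
      intro x y z
      obtain ⟨x, rfl⟩ := coprodMk_surjective A B x
      obtain ⟨y, rfl⟩ := coprodMk_surjective A B y
      obtain ⟨z, rfl⟩ := coprodMk_surjective A B z
      rw [← map_add, ← coprodMk_mul, ← coprodMk_mul, ← coprodMk_mul, ← map_add, mul_add]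
    right_distrib := by
      intro x y z
      obtain ⟨x, rfl⟩ := coprodMk_surjective A B x
      obtain ⟨y, rfl⟩ := coprodMk_surjective A B y
      obtain ⟨z, rfl⟩ := coprodMk_surjective A B z
      rw [← map_add, ← coprodMk_mul, ← coprodMk_mul, ← coprodMk_mul, ← map_add, add_mul]
    zero_mul := by
      intro x
      obtain ⟨x, rfl⟩ := coprodMk_surjective A B x
      change (0 : CoprodCarrier A B) * _ = 0
      rw [← map_zero (coprodMk A B), ← coprodMk_mul, zero_mul]
    mul_zero := by
      intro x
      obtain ⟨x, rfl⟩ := coprodMk_surjective A B x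
      change _ * (0 : CoprodCarrier A B) = 0
      rw [← map_zero (coprodMk A B), ← coprodMk_mul, mul_zero] }

instance : IsScalarTower K (CoprodCarrier A B) (CoprodCarrier A B) where
  smul_assoc c x y := by
    obtain ⟨x, rfl⟩ := coprodMk_surjective A B x
    obtain ⟨y, rfl⟩ := coprodMk_surjective A B y
    simp only [smul_eq_mul]
    rw [← map_smul, ← coprodMk_mul, ← coprodMk_mul, ← map_smul, smul_mul_assoc]

instance : SMulCommClass K (CoprodCarrier A B) (CoprodCarrier A B) where
  smul_comm c x y := by
    obtain ⟨x, rfl⟩ := coprodMk_surjective A B x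
    obtain ⟨y, rfl⟩ := coprodMk_surjective A B y
    simp only [smul_eq_mul]
    rw [← map_smul, ← coprodMk_mul, ← coprodMk_mul, ← map_smul, mul_smul_comm]

/-- The quotient map as an algebra homomorphism. -/
noncomputable def coprodMkHom : CoprodFree A B →ₙₐ[K] CoprodCarrier A B where
  toFun := coprodMk A B
  map_smul' c x := map_smul (coprodMk A B) c x
  map_zero' := map_zero (coprodMk A B)
  map_add' x y := map_add (coprodMk A B) x y
  map_mul' x y := coprodMk_mul A B x y

/-- The coproduct of two algebras of the variety: polynomials with variables in `A` and `B`, modulo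
the operations of `A` and of `B` and the identities in `I`. -/
noncomputable def coprodAlg : VarietyAlg.{u, v, w} I where
  carrier := CoprodCarrier A B
  sat φ hφ a := by
    choose b hb using fun t => coprodMk_surjective A B (a t)
    have ha : a = fun t => coprodMkHom A B (b t) := funext fun t => (hb t).symm
    rw [ha, ← map_lift (coprodMkHom A B) b φ]
    exact (Submodule.Quotient.mk_eq_zero _).2 ((coprodIdeal_isCoprodIdeal A B).sat φ hφ b)

/-- The first coproduct inclusion. -/
noncomputable def coprodInl : A ⟶ coprodAlg A B where
  hom :=
  { toFun := fun x => coprodMk A B (FreeNonUnitalNonAssocAlgebra.of K (Sum.inl x))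
    map_smul' := fun c x => by
      refine Eq.trans ?_ (map_smul (coprodMk A B) c _)
      exact (coprodMk_eq_iff A B).2 ((coprodIdeal_isCoprodIdeal A B).inl_smul c x)
    map_zero' := by
      have h := (coprodMk_eq_iff A B).2 ((coprodIdeal_isCoprodIdeal A B).inl_add 0 0)
      rw [map_add, add_zero] at h
      exact left_eq_add.1 h
    map_add' := fun x y => by
      refine Eq.trans ?_ (map_add (coprodMk A B) _ _)
      exact (coprodMk_eq_iff A B).2 ((coprodIdeal_isCoprodIdeal A B).inl_add x y)
    map_mul' := fun x y =>
      (coprodMk_eq_iff A B).2 ((coprodIdeal_isCoprodIdeal A B).inl_mul x y) }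

/-- The second coproduct inclusion. -/
noncomputable def coprodInr : B ⟶ coprodAlg A B where
  hom :=
  { toFun := fun x => coprodMk A B (FreeNonUnitalNonAssocAlgebra.of K (Sum.inr x))
    map_smul' := fun c x => by
      refine Eq.trans ?_ (map_smul (coprodMk A B) c _)
      exact (coprodMk_eq_iff A B).2 ((coprodIdeal_isCoprodIdeal A B).inr_smul c x)
    map_zero' := by
      have h := (coprodMk_eq_iff A B).2 ((coprodIdeal_isCoprodIdeal A B).inr_add 0 0)
      rw [map_add, add_zero] at h
      exact left_eq_add.1 h
    map_add' := fun x y => by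
      refine Eq.trans ?_ (map_add (coprodMk A B) _ _)
      exact (coprodMk_eq_iff A B).2 ((coprodIdeal_isCoprodIdeal A B).inr_add x y)
    map_mul' := fun x y =>
      (coprodMk_eq_iff A B).2 ((coprodIdeal_isCoprodIdeal A B).inr_mul x y) }

variable {A B}
variable {D : VarietyAlg.{u, v, w} I}

/-- The map on the free algebra induced by two morphisms. -/
noncomputable def coprodFreeDesc (f : A ⟶ D) (g : B ⟶ D) : CoprodFree A B →ₙₐ[K] D :=
  FreeNonUnitalNonAssocAlgebra.lift K (Sum.elim f.hom g.hom)

@[simp]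
lemma coprodFreeDesc_inl (f : A ⟶ D) (g : B ⟶ D) (x : A) :
    coprodFreeDesc f g (FreeNonUnitalNonAssocAlgebra.of K (Sum.inl x)) = f.hom x := by
  simp [coprodFreeDesc]

@[simp]
lemma coprodFreeDesc_inr (f : A ⟶ D) (g : B ⟶ D) (x : B) :
    coprodFreeDesc f g (FreeNonUnitalNonAssocAlgebra.of K (Sum.inr x)) = g.hom x := by
  simp [coprodFreeDesc]

lemma coprodIdeal_le_ker (f : A ⟶ D) (g : B ⟶ D) :
    coprodIdeal A B ≤ LinearMap.ker (coprodFreeDesc f g : CoprodFree A B →ₗ[K] D) := by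
  refine sInf_le (a := LinearMap.ker (coprodFreeDesc f g : CoprodFree A B →ₗ[K] D)) ?_
  have hk (z : CoprodFree A B) : z ∈ LinearMap.ker (coprodFreeDesc f g : CoprodFree A B →ₗ[K] D) ↔
    coprodFreeDesc f g z = 0 := Iff.rfl
  constructor <;> intros <;> simp_all only [map_mul, map_sub, map_add, map_smul, mul_zero,
    zero_mul, coprodFreeDesc_inl, coprodFreeDesc_inr, sub_self]
  rw [map_lift]
  exact D.sat _ ‹_› _

/-- The morphism out of the coproduct induced by two morphisms. -/
noncomputable def coprodDesc (f : A ⟶ D) (g : B ⟶ D) : coprodAlg A B ⟶ D where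
  hom :=
  { toFun := (coprodIdeal A B).liftQ (coprodFreeDesc f g : CoprodFree A B →ₗ[K] D)
      (coprodIdeal_le_ker f g)
    map_smul' := fun c x => map_smul _ c x
    map_zero' := map_zero _
    map_add' := fun x y => map_add _ x y
    map_mul' := fun x y => by
      obtain ⟨x, rfl⟩ := coprodMk_surjective A B x
      obtain ⟨y, rfl⟩ := coprodMk_surjective A B y
      exact map_mul (coprodFreeDesc f g) x y }

lemma coprodDesc_mk (f : A ⟶ D) (g : B ⟶ D) (x : CoprodFree A B) :
    (coprodDesc f g).hom (coprodMk A B x) = coprodFreeDesc f g x := rfl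

lemma coprod_hom_ext (m m' : coprodAlg A B ⟶ D) (hl : coprodInl A B ≫ m = coprodInl A B ≫ m')
    (hr : coprodInr A B ≫ m = coprodInr A B ≫ m') : m = m' := by
  have h : m.hom.comp (coprodMkHom A B) = m'.hom.comp (coprodMkHom A B) := by
    apply FreeNonUnitalNonAssocAlgebra.hom_ext
    rintro (x | x)
    · exact DFunLike.congr_fun (congrArg Hom.hom hl) x
    · exact DFunLike.congr_fun (congrArg Hom.hom hr) x
  ext x
  obtain ⟨x, rfl⟩ := coprodMk_surjective A B x
  exact DFunLike.congr_fun h x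

lemma coprodInl_desc (f : A ⟶ D) (g : B ⟶ D) : coprodInl A B ≫ coprodDesc f g = f := by
  ext x
  exact coprodFreeDesc_inl f g x

lemma coprodInr_desc (f : A ⟶ D) (g : B ⟶ D) : coprodInr A B ≫ coprodDesc f g = g := by
  ext x
  exact coprodFreeDesc_inr f g x

end Coproduct

instance : HasBinaryCoproducts (VarietyAlg.{u, v, w} I) :=
  have (A B : VarietyAlg.{u, v, w} I) : HasColimit (pair A B) :=
    ⟨⟨⟨BinaryCofan.mk (coprodInl A B) (coprodInr A B),
      BinaryCofan.IsColimit.mk _ (fun f g => coprodDesc f g)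
        (fun f g => coprodInl_desc f g) (fun f g => coprodInr_desc f g)
        (by
          intro T f g m hf hg
          exact coprod_hom_ext _ _ (hf.trans (coprodInl_desc f g).symm)
            (hg.trans (coprodInr_desc f g).symm))⟩⟩⟩
  hasBinaryCoproducts_of_hasColimit_pair _

instance : HasFiniteCoproducts (VarietyAlg.{u, v, w} I) :=
  hasFiniteCoproducts_of_has_binary_and_initial

end VarietyAlg

/-! Suppose `p * q ≠ 0` in some algebra. Since 2 is invertible, all squares vanish, so `p` spans a
one-dimensional algebra `N` with zero multiplication. Let `y`, `z` be the two copies of its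
generator in `N + N`. Anti-associativity kills `y(yz)` and `z(yz)`, so `N + N` is spanned by `y`,
`z`, `yz`, and `N ⋄ N` is the line through `g = yz`; it is nonzero because `y ↦ p`, `z ↦ q` sends
`g` to `p * q` (`exists_cosmash_span_singleton`).

Inside `N ⋄ N` the generator `g` forgets that it is a product: it can be mapped to any element of
any algebra of the variety (`exists_hom_apply_eq`). Injectivity of `Φ` says that a relation
satisfied by `yz` in `B + N + N` already holds for `g` in `B + (N ⋄ N)`, provided that the element
concerned lies in `B ⋄ (N ⋄ N)` (`eq_zero_of_mono_cosmashPhi`). Thus a vanishing product with last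
factor `yz` yields one with an arbitrary last factor.

This shortens vanishing products twice. Products `a(b(cd))` are always zero
(`IsAntiAssociative.mul_mul_mul`); hence `a(bg) = 0`, so `a(bc) = 0` throughout the variety; hence
`pg = 0`, so `p * q = 0`, a contradiction. -/

namespace VarietyAlg

variable {K : Type u} [Field K] {T : Type w} {I : Set (FreeNonUnitalNonAssocAlgebra K T)}

/-! ### Elements of limits and colimits in a variety -/

/-- A subalgebra of an algebra of the variety, as an object of the variety. -/
def subAlg (A : VarietyAlg.{u, v, w} I) (S : NonUnitalSubalgebra K A) :
    VarietyAlg.{u, v, w} I where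
  carrier := S
  sat φ hφ a := by
    apply Subtype.ext
    exact (map_lift (NonUnitalSubalgebraClass.subtype S) a φ).trans (A.sat φ hφ _)

/-- An element killed by `f` lies in the concrete kernel `kerAlg f`, whose inclusion vanishes once
`f` is cancelled. -/
lemma eq_zero_of_mono {A B : VarietyAlg.{u, v, w} I} (f : A ⟶ B) [Mono f] {x : A}
    (hx : f.hom x = 0) : x = 0 := by
  have h : kerι f = 0 := by
    rw [← cancel_mono f, zero_comp]
    ext y
    exact y.2
  exact DFunLike.congr_fun (congrArg Hom.hom h) (⟨x, hx⟩ : kerSub f)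

/-- The categorical kernel is only known up to isomorphism; its universal property receives the
concrete kernel, which contains `x`. -/
lemma exists_kernel_ι_eq {A B : VarietyAlg.{u, v, w} I} (f : A ⟶ B) {x : A}
    (hx : f.hom x = 0) : ∃ y : (kernel f : VarietyAlg.{u, v, w} I), (kernel.ι f).hom y = x := by
  have h : kerι f ≫ f = 0 := by
    ext y
    exact y.2
  exact ⟨(kernel.lift f (kerι f) h).hom (⟨x, hx⟩ : kerSub f),
    DFunLike.congr_fun (congrArg Hom.hom (kernel.lift_ι f (kerι f) h)) (⟨x, hx⟩ : kerSub f)⟩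

lemma prod_ext {A B : VarietyAlg.{u, v, w} I} {x y : (A ⨯ B : VarietyAlg.{u, v, w} I)}
    (h₁ : (prod.fst : A ⨯ B ⟶ A).hom x = (prod.fst : A ⨯ B ⟶ A).hom y)
    (h₂ : (prod.snd : A ⨯ B ⟶ B).hom x = (prod.snd : A ⨯ B ⟶ B).hom y) : x = y := by
  let toProd : A ⨯ B ⟶ prodAlg A B :=
    ⟨NonUnitalAlgHom.prod (prod.fst : A ⨯ B ⟶ A).hom (prod.snd : A ⨯ B ⟶ B).hom⟩
  let ofProd : prodAlg A B ⟶ A ⨯ B :=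
    prod.lift ⟨NonUnitalAlgHom.fst K A B⟩ ⟨NonUnitalAlgHom.snd K A B⟩
  have h : toProd ≫ ofProd = 𝟙 (A ⨯ B) := by
    apply Limits.prod.hom_ext
    · rw [Category.assoc, prod.lift_fst, Category.id_comp]
      rfl
    · rw [Category.assoc, prod.lift_snd, Category.id_comp]
      rfl
  have key (z : (A ⨯ B : VarietyAlg.{u, v, w} I)) : ofProd.hom (toProd.hom z) = z :=
    DFunLike.congr_fun (congrArg Hom.hom h) z
  have hxy : toProd.hom x = toProd.hom y := Prod.ext h₁ h₂
  rw [← key x, ← key y, hxy]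

/-- A sum of two algebras is generated by the images of the summands. -/
lemma mem_of_coprod {A B : VarietyAlg.{u, v, w} I}
    (S : NonUnitalSubalgebra K (A ⨿ B : VarietyAlg.{u, v, w} I))
    (hl : ∀ a, (coprod.inl : A ⟶ A ⨿ B).hom a ∈ S)
    (hr : ∀ b, (coprod.inr : B ⟶ A ⨿ B).hom b ∈ S)
    (x : (A ⨿ B : VarietyAlg.{u, v, w} I)) : x ∈ S := by
  let f : A ⟶ subAlg (A ⨿ B) S := ⟨NonUnitalAlgHom.codRestrict (coprod.inl : A ⟶ A ⨿ B).hom S hl⟩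
  let g : B ⟶ subAlg (A ⨿ B) S := ⟨NonUnitalAlgHom.codRestrict (coprod.inr : B ⟶ A ⨿ B).hom S hr⟩
  let i : subAlg (A ⨿ B) S ⟶ A ⨿ B := ⟨NonUnitalSubalgebraClass.subtype S⟩
  -- The corestricted inclusions induce a section of `S ↪ A + B`, which forces `S` to be everything.
  have h : coprod.desc f g ≫ i = 𝟙 (A ⨿ B) := by
    apply Limits.coprod.hom_ext
    · rw [← Category.assoc, coprod.inl_desc, Category.comp_id]
      rfl
    · rw [← Category.assoc, coprod.inr_desc, Category.comp_id]
      rfl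
  have hx : i.hom ((coprod.desc f g).hom x) = x := DFunLike.congr_fun (congrArg Hom.hom h) x
  rw [← hx]
  exact Subtype.property (p := (· ∈ S)) ((coprod.desc f g).hom x)

lemma coprod_inl_desc_apply {A B D : VarietyAlg.{u, v, w} I} (f : A ⟶ D) (g : B ⟶ D) (a : A) :
    (coprod.desc f g).hom ((coprod.inl : A ⟶ A ⨿ B).hom a) = f.hom a :=
  DFunLike.congr_fun (congrArg Hom.hom (coprod.inl_desc f g)) a

lemma coprod_inr_desc_apply {A B D : VarietyAlg.{u, v, w} I} (f : A ⟶ D) (g : B ⟶ D) (b : B) :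
    (coprod.desc f g).hom ((coprod.inr : B ⟶ A ⨿ B).hom b) = g.hom b :=
  DFunLike.congr_fun (congrArg Hom.hom (coprod.inr_desc f g)) b

/-! ### Elements of cosmash products -/

lemma binSigma_fst (A B : VarietyAlg.{u, v, w} I) :
    binSigma A B ≫ prod.fst = coprod.desc (𝟙 A) 0 := by
  ext1 <;> simp [binSigma, coprod.inl_desc, coprod.inr_desc, prod.lift_fst]

lemma binSigma_snd (A B : VarietyAlg.{u, v, w} I) :
    binSigma A B ≫ prod.snd = coprod.desc 0 (𝟙 B) := by
  ext1 <;> simp [binSigma, coprod.inl_desc, coprod.inr_desc, prod.lift_snd]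

/-- An element of `A + B` which vanishes on both summands comes from `A ⋄ B`. -/
lemma exists_cosmashι_eq {A B : VarietyAlg.{u, v, w} I} {x : (A ⨿ B : VarietyAlg.{u, v, w} I)}
    (h₁ : (coprod.desc (𝟙 A) (0 : B ⟶ A)).hom x = 0)
    (h₂ : (coprod.desc (0 : A ⟶ B) (𝟙 B)).hom x = 0) :
    ∃ y : (cosmash A B : VarietyAlg.{u, v, w} I), (cosmashι A B).hom y = x := by
  apply exists_kernel_ι_eq
  apply prod_ext
  · rw [map_zero, ← comp_hom_apply, binSigma_fst, h₁]
  · rw [map_zero, ← comp_hom_apply, binSigma_snd, h₂]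

lemma cosmashι_eq_zero {A B : VarietyAlg.{u, v, w} I} {x : (cosmash A B : VarietyAlg.{u, v, w} I)}
    (h : (cosmashι A B).hom x = 0) : x = 0 := by
  have : Mono (cosmashι A B) := inferInstanceAs (Mono (kernel.ι (binSigma A B)))
  exact eq_zero_of_mono _ h

/-- If `Φ` is a monomorphism, then an element of `A + (B ⋄ C)` which vanishes on both summands
and in `A + B + C` is zero. -/
lemma eq_zero_of_mono_cosmashPhi {A B C : VarietyAlg.{u, v, w} I} [Mono (cosmashPhi A B C)]
    {x : (A ⨿ cosmash B C : VarietyAlg.{u, v, w} I)}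
    (h₁ : (coprod.desc (𝟙 A) (0 : cosmash B C ⟶ A)).hom x = 0)
    (h₂ : (coprod.desc (0 : A ⟶ cosmash B C) (𝟙 (cosmash B C))).hom x = 0)
    (h : (coprod.desc coprod.inl (cosmashι B C ≫ coprod.inr) :
      A ⨿ cosmash B C ⟶ A ⨿ (B ⨿ C)).hom x = 0) : x = 0 := by
  obtain ⟨y, rfl⟩ := exists_cosmashι_eq h₁ h₂
  -- Up to the inclusion of the ternary cosmash product, `Φ` is the map appearing in `h`; that
  -- inclusion is a kernel, so the composite is again mono.
  have hΦ : cosmashPhi A B C ≫ terCosmashι A B C =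
      cosmashι A (cosmash B C) ≫ coprod.desc coprod.inl (cosmashι B C ≫ coprod.inr) := by
    refine (kernel.lift_ι _ _ _).trans ?_
    congr 1
    ext1 <;> simp [coprod.inl_desc, coprod.inr_desc]
  have : Mono (terCosmashι A B C) := inferInstanceAs (Mono (kernel.ι (terSigma A B C)))
  have hy : y = 0 := by
    refine eq_zero_of_mono (cosmashPhi A B C ≫ terCosmashι A B C) ?_
    rw [hΦ]
    exact h
  rw [hy, map_zero]

end VarietyAlg

/-! ### Anti-commutative and anti-associative algebras -/

section Identities

variable {K : Type u} [Field K] {A : Type*} [NonUnitalNonAssocRing A] [Module K A]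

lemma eq_zero_of_add_self_eq_zero (hK : ringChar K ≠ 2) {x : A} (h : x + x = 0) : x = 0 := by
  rw [← two_smul K x] at h
  exact (smul_eq_zero.1 h).resolve_left (Ring.two_ne_zero hK)

lemma IsAntiCommutative.mul_self (hK : ringChar K ≠ 2) (hA : IsAntiCommutative A) (x : A) :
    x * x = 0 :=
  eq_zero_of_add_self_eq_zero hK (hA x x)

/-- The five bracketings of `abcd` form a pentagon, each edge of which is a change of sign. The
pentagon has odd length, so a bracketing equals its own negative. -/
lemma IsAntiAssociative.mul_mul_mul (hK : ringChar K ≠ 2) (hA : IsAntiAssociative A)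
    (a b c d : A) : a * (b * (c * d)) = 0 := by
  have h₁ := hA a b (c * d)
  have h₂ := hA (a * b) c d
  have h₃ := congrArg (· * d) (hA a b c)
  have h₄ := hA a (b * c) d
  have h₅ := congrArg (a * ·) (hA b c d)
  simp only [add_mul, mul_add, zero_mul, mul_zero] at h₃ h₅
  apply eq_zero_of_add_self_eq_zero hK
  -- The alternating sum of the five edge relations telescopes.
  have e : a * (b * (c * d)) + a * (b * (c * d)) =
      (a * (b * (c * d)) + a * b * (c * d)) - (a * b * (c * d) + a * b * c * d)
      + (a * (b * c) * d + a * b * c * d) - (a * (b * c * d) + a * (b * c) * d)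
      + (a * (b * (c * d)) + a * (b * c * d)) := by abel
  rw [e, h₁, h₂, h₃, h₄, h₅]
  simp

end Identities

/-! ### One-dimensional algebras and their cosmash product -/

namespace VarietyAlg

variable {K : Type u} [Field K] {T : Type w} {I : Set (FreeNonUnitalNonAssocAlgebra K T)}

/-- A one-dimensional algebra with zero multiplication is free on any of its generators, among the
algebras in which all squares vanish. -/
lemma exists_hom_apply_eq {U B : VarietyAlg.{u, v, w} I} {g : U} (hg : g ≠ 0)
    (hspan : ∀ x : U, ∃ r : K, r • g = x) (hgg : g * g = 0) {b : B} (hbb : b * b = 0) :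
    ∃ f : U ⟶ B, f.hom g = b := by
  -- `r x` is the coordinate of `x` along `g`; it is unique as `g ≠ 0`, which gives its linearity.
  choose r hr using hspan
  have huniq {s t : K} (h : s • g = t • g) : s = t := smul_left_injective K hg h
  refine ⟨⟨
    { toFun := fun x => r x • b
      map_smul' := ?_
      map_zero' := ?_
      map_add' := ?_
      map_mul' := ?_ }⟩, ?_⟩
  · intro c x
    have : r (c • x) = c * r x := huniq (by rw [hr, mul_smul, hr])
    simp [this, mul_smul]
  · have : r 0 = 0 := huniq (by rw [hr, zero_smul])
    simp [this]
  · intro x y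
    have : r (x + y) = r x + r y := huniq (by rw [hr, add_smul, hr, hr])
    simp [this, add_smul]
  · intro x y
    have : r (x * y) = 0 := huniq (by
      rw [hr, zero_smul]
      nth_rw 1 [← hr x, ← hr y]
      rw [smul_mul_smul_comm, hgg, smul_zero])
    rw [this, smul_mul_smul_comm, hbb, zero_smul, smul_zero]
  · have : r g = 1 := huniq (by rw [hr, one_smul])
    change r g • b = b
    rw [this, one_smul]

/-- A nonzero element with zero square spans a one-dimensional algebra. -/
lemma exists_span_singleton {A : VarietyAlg.{u, v, w} I} {p : A} (hp : p ≠ 0)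
    (hpp : p * p = 0) :
    ∃ (N : VarietyAlg.{u, v, w} I) (n : N), n ≠ 0 ∧ ∀ x : N, ∃ r : K, r • n = x := by
  let S : NonUnitalSubalgebra K A :=
    { (Submodule.span K {p} : Submodule K A) with
      mul_mem' := by
        intro x y hx hy
        obtain ⟨r, rfl⟩ := Submodule.mem_span_singleton.1 hx
        obtain ⟨s, rfl⟩ := Submodule.mem_span_singleton.1 hy
        rw [smul_mul_smul_comm, hpp, smul_zero]
        exact (Submodule.span K {p}).zero_mem }
  refine ⟨subAlg A S, (⟨p, Submodule.mem_span_singleton_self p⟩ : S),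
    fun h => hp (congrArg Subtype.val h), fun x => ?_⟩
  obtain ⟨r, hr⟩ := Submodule.mem_span_singleton.1
    (show (show S from x).1 ∈ Submodule.span K {p} from (show S from x).2)
  exact ⟨r, Subtype.ext hr⟩

/-- In a non-abelian variety of anti-commutative, anti-associative algebras there is a cosmash
product of two algebras `N` which is spanned by a single nonzero product `y z`. -/
lemma exists_cosmash_span_singleton (hK : ringChar K ≠ 2)
    (hcomm : ∀ A : VarietyAlg.{u, v, w} I, IsAntiCommutative A)
    (hassoc : ∀ A : VarietyAlg.{u, v, w} I, IsAntiAssociative A)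
    {A : VarietyAlg.{u, v, w} I} {p q : A} (hpq : p * q ≠ 0) :
    ∃ (N : VarietyAlg.{u, v, w} I) (g : (cosmash N N : VarietyAlg.{u, v, w} I))
      (y z : (N ⨿ N : VarietyAlg.{u, v, w} I)),
      (cosmashι N N).hom g = y * z ∧ g ≠ 0 ∧ ∀ x, ∃ r : K, r • g = x := by
  have sq (B : VarietyAlg.{u, v, w} I) (b : B) : b * b = 0 := (hcomm B).mul_self hK b
  have hp : p ≠ 0 := by
    rintro rfl
    exact hpq (zero_mul q)
  obtain ⟨N, n, hn, hspan⟩ := exists_span_singleton hp (sq A p)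
  let y := (coprod.inl : N ⟶ N ⨿ N).hom n
  let z := (coprod.inr : N ⟶ N ⨿ N).hom n
  have hzy : z * y = -(y * z) := eq_neg_of_add_eq_zero_left (hcomm (N ⨿ N) z y)
  have hyyz : y * (y * z) = 0 := by
    rw [eq_neg_of_add_eq_zero_left (hassoc (N ⨿ N) y y z), sq, zero_mul, neg_zero]
  have hzyz : z * (y * z) = 0 := by
    -- Here `z(zy) = -(zz)y = 0`, and `zy = -yz`.
    have h := eq_neg_of_add_eq_zero_left (hassoc (N ⨿ N) z z y)
    rw [sq, zero_mul, neg_zero, hzy, mul_neg, neg_eq_zero] at h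
    exact h
  have hyzy : y * z * y = 0 := by
    rw [eq_neg_of_add_eq_zero_left (hcomm (N ⨿ N) (y * z) y), hyyz, neg_zero]
  have hyzz : y * z * z = 0 := by
    rw [eq_neg_of_add_eq_zero_left (hcomm (N ⨿ N) (y * z) z), hzyz, neg_zero]
  -- The span of `y`, `z`, `yz`. Among products of these generators only `yz` and `zy = -yz`
  -- survive, whence the coefficient `a * b' - b * a'` below.
  let S : NonUnitalSubalgebra K (N ⨿ N : VarietyAlg.{u, v, w} I) :=
    { carrier := {x | ∃ a b c : K, x = a • y + b • z + c • (y * z)}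
      add_mem' := by
        rintro _ _ ⟨a, b, c, rfl⟩ ⟨a', b', c', rfl⟩
        exact ⟨a + a', b + b', c + c', by simp only [add_smul]; abel⟩
      zero_mem' := ⟨0, 0, 0, by simp⟩
      smul_mem' := by
        rintro r _ ⟨a, b, c, rfl⟩
        exact ⟨r * a, r * b, r * c, by simp only [mul_smul, smul_add]⟩
      mul_mem' := by
        rintro _ _ ⟨a, b, c, rfl⟩ ⟨a', b', c', rfl⟩
        refine ⟨0, 0, a * b' - b * a', ?_⟩
        simp only [add_mul, mul_add, smul_mul_smul_comm, sq, hzy, hyyz, hzyz, hyzy, hyzz,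
          smul_zero, smul_neg, sub_smul, zero_smul]
        abel }
  have hS := mem_of_coprod S
    (fun x => by
      obtain ⟨r, rfl⟩ := hspan x
      exact ⟨r, 0, 0, by simp [y]⟩)
    (fun x => by
      obtain ⟨r, rfl⟩ := hspan x
      exact ⟨0, r, 0, by simp [z]⟩)
  have hy₁ : (coprod.desc (𝟙 N) (0 : N ⟶ N)).hom y = n := coprod_inl_desc_apply _ _ _
  have hz₁ : (coprod.desc (𝟙 N) (0 : N ⟶ N)).hom z = 0 := coprod_inr_desc_apply _ _ _
  have hy₂ : (coprod.desc (0 : N ⟶ N) (𝟙 N)).hom y = 0 := coprod_inl_desc_apply _ _ _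
  have hz₂ : (coprod.desc (0 : N ⟶ N) (𝟙 N)).hom z = n := coprod_inr_desc_apply _ _ _
  obtain ⟨g, hg⟩ := exists_cosmashι_eq (x := y * z)
    (by rw [map_mul, hz₁, mul_zero]) (by rw [map_mul, hy₂, zero_mul])
  refine ⟨N, g, y, z, hg, ?_, fun x => ?_⟩
  · rintro rfl
    -- If `yz` were zero, the morphism `N + N ⟶ A` with `y ↦ p`, `z ↦ q` would give `p * q = 0`.
    obtain ⟨f₁, hf₁⟩ := exists_hom_apply_eq hn hspan (sq N n) (sq A p)
    obtain ⟨f₂, hf₂⟩ := exists_hom_apply_eq hn hspan (sq N n) (sq A q)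
    apply hpq
    have h := congrArg (coprod.desc f₁ f₂).hom hg
    rw [map_zero, map_zero, map_mul, coprod_inl_desc_apply, coprod_inr_desc_apply, hf₁, hf₂] at h
    exact h.symm
  -- The two projections to `N` read off the coefficients of `y` and `z`, which vanish on `N ⋄ N`.
  · obtain ⟨a, b, c, h⟩ := hS ((cosmashι N N).hom x)
    have h₁ : (coprod.desc (𝟙 N) (0 : N ⟶ N)).hom ((cosmashι N N).hom x) = 0 :=
      DFunLike.congr_fun (congrArg Hom.hom (cosmashι_desc_fst N N)) x
    have h₂ : (coprod.desc (0 : N ⟶ N) (𝟙 N)).hom ((cosmashι N N).hom x) = 0 :=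
      DFunLike.congr_fun (congrArg Hom.hom (cosmashι_desc_snd N N)) x
    have ha : a = 0 := by
      rw [h, map_add, map_add, map_smul, map_smul, map_smul, map_mul, hy₁, hz₁, mul_zero,
        smul_zero, smul_zero, add_zero, add_zero] at h₁
      exact (smul_eq_zero.1 h₁).resolve_right hn
    have hb : b = 0 := by
      rw [h, map_add, map_add, map_smul, map_smul, map_smul, map_mul, hy₂, hz₂, zero_mul,
        smul_zero, smul_zero, zero_add, add_zero] at h₂
      exact (smul_eq_zero.1 h₂).resolve_right hn
    refine ⟨c, (sub_eq_zero.1 (cosmashι_eq_zero ?_))⟩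
    rw [map_sub, map_smul, hg, h, ha, hb, zero_smul, zero_smul, zero_add, zero_add, sub_self]

end VarietyAlg

/-! ### Shortening the vanishing products -/

open VarietyAlg in
theorem proposition8p5 {K : Type u} [Field K] (hK : ringChar K ≠ 2) {T : Type w}
    (I : Set (FreeNonUnitalNonAssocAlgebra K T))
    (hcomm : ∀ A : VarietyAlg.{u, v, w} I, IsAntiCommutative A)
    (hassoc : ∀ A : VarietyAlg.{u, v, w} I, IsAntiAssociative A)
    (hcosmash : CosmashAssociative (VarietyAlg.{u, v, w} I)) :
    ∀ A : VarietyAlg.{u, v, w} I, IsAbelianAlgebra A := by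
  intro A p q
  by_contra hpq
  have sq (B : VarietyAlg.{u, v, w} I) (b : B) : b * b = 0 := (hcomm B).mul_self hK b
  obtain ⟨N, g, y, z, hg, hg₀, hspan⟩ := exists_cosmash_span_singleton hK hcomm hassoc hpq
  have hmono (B : VarietyAlg.{u, v, w} I) : Mono (cosmashPhi B N N) := by
    have := (hcosmash B N N).1
    infer_instance
  have triple (B : VarietyAlg.{u, v, w} I) (a b c : B) : a * (b * c) = 0 := by
    have := hmono B
    obtain ⟨f, hf⟩ := exists_hom_apply_eq hg₀ hspan (sq _ g) (sq B c)
    -- The element `a(bg)` dies in `B` because of `g` and in `N ⋄ N` because of `a`; in `B + N + N`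
    -- it becomes the fourfold product `a(b(yz))`.
    have h := eq_zero_of_mono_cosmashPhi
      (x := (coprod.inl : B ⟶ B ⨿ cosmash N N).hom a *
        ((coprod.inl : B ⟶ B ⨿ cosmash N N).hom b *
          (coprod.inr : cosmash N N ⟶ B ⨿ cosmash N N).hom g))
      (by simp only [map_mul, coprod_inr_desc_apply, zero_hom_apply, mul_zero])
      (by simp only [map_mul, coprod_inl_desc_apply, zero_hom_apply, zero_mul])
      (by
        simp only [map_mul, coprod_inr_desc_apply, comp_hom_apply, hg]
        exact (hassoc _).mul_mul_mul hK _ _ _ _)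
    -- Specialise `g` to `c`.
    have h' := congrArg (coprod.desc (𝟙 B) f).hom h
    simpa only [map_mul, map_zero, coprod_inl_desc_apply, coprod_inr_desc_apply, id_hom_apply,
      hf] using h'
  have := hmono A
  obtain ⟨f, hf⟩ := exists_hom_apply_eq hg₀ hspan (sq _ g) (sq A q)
  -- The same argument one degree lower: `pg` becomes `p(yz)`, which `triple` kills in `A + N + N`.
  have h := eq_zero_of_mono_cosmashPhi
    (x := (coprod.inl : A ⟶ A ⨿ cosmash N N).hom p *
      (coprod.inr : cosmash N N ⟶ A ⨿ cosmash N N).hom g)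
    (by simp only [map_mul, coprod_inr_desc_apply, zero_hom_apply, mul_zero])
    (by simp only [map_mul, coprod_inl_desc_apply, zero_hom_apply, zero_mul])
    (by
      simp only [map_mul, coprod_inr_desc_apply, comp_hom_apply, hg]
      exact triple _ _ _ _)
  have h' := congrArg (coprod.desc (𝟙 A) f).hom h
  apply hpq
  simpa only [map_mul, map_zero, coprod_inl_desc_apply, coprod_inr_desc_apply, id_hom_apply,
    hf] using h'
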